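/- Let $m\ge 1$. An $m$-ballot path of size $n$ is a lattice path from $(0,0)$ to $(mn,n)$ with steps $(0,1)$ (written $1$) and $(1,0)$ (written $0$) that stays weakly above the line $y=x/m$; it is primitive if it is nonempty and meets this line only at its two endpoints. A rotation of an $m$-ballot path exchanges a step $0$ with a primitive $m$-ballot path $c$ (up to translation) that immediately follows it (that is, $a\,0\,c\,b\mapsto a\,c\,0\,b$). The $m$-Tamari order on $m$-ballot paths of size $n$ is defined by $P\le Q$ if $Q$ is obtained from $P$ by a (possibly empty) sequence of rotations. Let $$\Phi^{(m)}(x,y)=\sum_{n\ge 0}\ \sum_{[P,Q]} x^{c(P)}y^{n}\in\mathbb Z[x][[y]]$$ be the generating function of $m$-Tamari intervals, where the inner sum is over pairs $P\le Q$ of $m$-ballot paths of size $n$, and $c(P)$ is the number of contacts of the lower path $P$ with the line $y=x/m$ after the origin. Then $$\Phi^{(m)}=B^{(m)}(\Phi^{(m)},\dots,\Phi^{(m)})+1,$$ where, with $f\succ g:=fg$, $\ f\prec_\delta g:=f\,\Delta(g)$ and $\Delta(g):=\dfrac{x\,g(x,y)-g(1,y)}{x-1}$, the $(m+1)$-linear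 operator $B^{(m)}$ is $$B^{(m)}(f,g_1,\dots,g_m)=f\succ xy\prec_\delta\bigl(g_1\prec_\delta(\cdots\prec_\delta(g_{m-1}\prec_\delta g_m))\cdots\bigr)=xy\,f\,\Delta\bigl(g_1\,\Delta(g_2\,\Delta(\cdots\Delta(g_m)\cdots))\bigr).$$ -/

import Mathlib

open Polynomial in
/-- The divided difference of a polynomial in `x`: the quotient `(x p(x) - p(1)) / (x - 1)`.
The division is exact, see `MTamari.sub_one_mul_polyDelta`. -/
noncomputable def MTamari.polyDelta (p : ℤ[X]) : ℤ[X] :=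
  (X * p - C (p.eval 1)) /ₘ (X - C 1)

open Polynomial in
theorem MTamari.sub_one_mul_polyDelta (p : ℤ[X]) :
    (X - 1) * MTamari.polyDelta p = X * p - C (p.eval 1) := by
  have h : (X * p - C (p.eval 1)).IsRoot (1 : ℤ) := by simp
  simpa [MTamari.polyDelta] using Polynomial.mul_divByMonic_eq_iff_isRoot.2 h

namespace MTamari

/-! ### Paths

A path is a word on `{1, 0}`, coded by booleans: `true` is the up step `(0, 1)` and `false` is the
step `(1, 0)`. After the prefix `w` the path is at the point `(w.count false, w.count true)`. -/

/-- `w` is an `m`-ballot path of size `n`: it goes from `(0, 0)` to `(m n, n)` and all its points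
`(a, b)` satisfy `b ≥ a / m`. -/
def IsBallotPath (m n : ℕ) (w : List Bool) : Prop :=
  w.count true = n ∧ w.count false = m * n ∧
    ∀ k ≤ w.length, (w.take k).count false ≤ m * (w.take k).count true

/-- After `k` steps the path `w` is on the line `y = x / m`. -/
def TouchesAt (m : ℕ) (w : List Bool) (k : ℕ) : Prop :=
  (w.take k).count false = m * (w.take k).count true

instance (m : ℕ) (w : List Bool) (k : ℕ) : Decidable (TouchesAt m w k) :=
  inferInstanceAs (Decidable (_ = _))

/-- The number of contacts of `w` with the line `y = x / m` after the origin. -/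
def contacts (m : ℕ) (w : List Bool) : ℕ :=
  ((Finset.Icc 1 w.length).filter fun k => TouchesAt m w k).card

/-- `c` is a primitive `m`-ballot path: it is nonempty, and its only contacts with the line
`y = x / m` are its two endpoints. -/
def IsPrimitive (m : ℕ) (c : List Bool) : Prop :=
  c ≠ [] ∧ (∃ n, IsBallotPath m n c) ∧ ∀ k, 0 < k → k < c.length → ¬ TouchesAt m c k

/-- The type of `m`-ballot paths of size `n`. -/
def BallotPath (m n : ℕ) : Type := {w : List Bool // IsBallotPath m n w}

instance (m n : ℕ) : Finite (BallotPath m n) := by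
  refine Set.Finite.to_subtype (s := {w | IsBallotPath m n w})
    ((List.finite_length_eq Bool (n + m * n)).subset ?_)
  rintro w ⟨h1, h2, -⟩
  simp only [Set.mem_ofPred_eq]
  rw [← List.count_true_add_count_false (l := w), h1, h2]

/-- `q` is obtained from `p` by a rotation: a step `0` of `p` followed by a primitive path `c` is
exchanged with `c`. -/
def Rotation {m n : ℕ} (p q : BallotPath m n) : Prop :=
  ∃ a c b : List Bool, IsPrimitive m c ∧
    p.1 = a ++ [false] ++ c ++ b ∧ q.1 = a ++ c ++ [false] ++ b

theorem Rotation.lt {m n : ℕ} {p q : BallotPath m n} (h : Rotation p q) : p.1 < q.1 := by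
  obtain ⟨a, c, b, ⟨hc, ⟨k, -, -, hb⟩, -⟩, hp, hq⟩ := h
  rw [hp, hq]
  cases c with
  | nil => exact absurd rfl hc
  | cons x c =>
    cases x with
    | false => simpa using hb 1 (by simp)
    | true =>
      simp only [List.append_assoc, List.cons_append, List.nil_append]
      exact List.append_left_lt (List.Lex.rel (by decide))

/-- The `m`-Tamari order on `m`-ballot paths of size `n`: `p ≤ q` when `q` can be reached from `p`
by a (possibly empty) sequence of rotations. -/
instance (m n : ℕ) : PartialOrder (BallotPath m n) where
  le := Relation.ReflTransGen Rotation
  le_refl _ := Relation.ReflTransGen.refl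
  le_trans _ _ _ := Relation.ReflTransGen.trans
  le_antisymm p q hpq hqp := by
    have key : ∀ {p q : BallotPath m n}, Relation.ReflTransGen Rotation p q → p.1 ≤ q.1 := by
      intro p q h
      induction h with
      | refl => exact le_refl _
      | tail _ h ih => exact ih.trans h.lt.le
    exact Subtype.ext (le_antisymm (key hpq) (key hqp))

/-- The intervals `[p, q]` of the `m`-Tamari order on paths of size `n`, as pairs `p ≤ q`. -/
def TamariInterval (m n : ℕ) : Type := {I : BallotPath m n × BallotPath m n // I.1 ≤ I.2}

instance (m n : ℕ) : Finite (TamariInterval m n) := Subtype.finite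

noncomputable instance (m n : ℕ) : Fintype (TamariInterval m n) := Fintype.ofFinite _

/-! ### Series

Series in `x` and `y` are power series in `y` whose coefficients are polynomials in `x`. -/

/-- The ring `ℤ[x][[y]]`. -/
abbrev Series : Type := PowerSeries (Polynomial ℤ)

/-- The variable `x`. -/
noncomputable def x : Series := PowerSeries.C Polynomial.X

/-- The variable `y`. -/
noncomputable def y : Series := PowerSeries.X

/-- The generating function of `m`-Tamari intervals: `y` marks the size of the paths and `x` marks
the number of contacts of the lower path. -/
noncomputable def intervalSeries (m : ℕ) : Series :=
  PowerSeries.mk fun n => ∑ I : TamariInterval m n, Polynomial.X ^ contacts m I.1.1.1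

/-- The specialization `g(1, y)`. -/
noncomputable def atOne (g : Series) : Series :=
  PowerSeries.map (Polynomial.C.comp (Polynomial.evalRingHom 1)) g

/-- `Δ(g) = (x g(x, y) - g(1, y)) / (x - 1)`, computed on each coefficient. It is the only series
with the property `sub_one_mul_delta`. -/
noncomputable def delta (g : Series) : Series :=
  PowerSeries.mk fun n => polyDelta (PowerSeries.coeff n g)

theorem sub_one_mul_delta (g : Series) : (x - 1) * delta g = x * g - atOne g := by
  have h : (x - 1 : Series) = PowerSeries.C (Polynomial.X - 1) := by simp [x]
  ext1 n
  rw [h, PowerSeries.coeff_C_mul]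
  simp [delta, sub_one_mul_polyDelta, atOne, x, PowerSeries.coeff_C_mul]

/-- The left product `f ≻ g`. -/
noncomputable def leftProd (f g : Series) : Series := f * g

/-- The right product `f ≺_δ g`. -/
noncomputable def rightProd (f g : Series) : Series := f * delta g

/-- `g₁ ≺_δ (g₂ ≺_δ (⋯ ≺_δ (gₘ₋₁ ≺_δ gₘ)))` for the list `[g₁, …, gₘ]` (the value for the empty list
plays no role). -/
noncomputable def iterRightProd : List Series → Series
  | [] => 1
  | [g] => g
  | g :: h :: l => rightProd g (iterRightProd (h :: l))

/-- The operator `B⁽ᵐ⁾(f, g₁, …, gₘ) = f ≻ xy ≺_δ (g₁ ≺_δ (⋯ ≺_δ (gₘ₋₁ ≺_δ gₘ)))`. -/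
noncomputable def opB {m : ℕ} (f : Series) (g : Fin m → Series) : Series :=
  leftProd f (rightProd (x * y) (iterRightProd (List.ofFn g)))

theorem polyDelta_add (p q : Polynomial ℤ) : polyDelta (p + q) = polyDelta p + polyDelta q := by
  have h : (Polynomial.X - 1 : Polynomial ℤ) ≠ 0 := Polynomial.X_sub_C_ne_zero 1
  apply mul_left_cancel₀ h
  rw [mul_add, sub_one_mul_polyDelta, sub_one_mul_polyDelta, sub_one_mul_polyDelta,
    Polynomial.eval_add, Polynomial.C_add]
  ring

theorem delta_add (f g : Series) : delta (f + g) = delta f + delta g := by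
  ext1 n
  simp [delta, polyDelta_add]

/-- The operator `B⁽ᵐ⁾` is `m + 1`-linear. -/
theorem opB_multilinear (m : ℕ) (hm : 1 ≤ m) :
    ∃ B : MultilinearMap ℤ (fun _ : Fin (m + 1) => Series) Series,
      ∀ (f : Series) (g : Fin m → Series), B (Fin.cons f g) = opB f g := by
  let D : Series →ₗ[ℤ] Series := (AddMonoidHom.mk' delta delta_add).toIntLinearMap
  let P (k : ℕ) (E : MultilinearMap ℤ (fun _ : Fin k => Series) Series) :
      MultilinearMap ℤ (fun _ : Fin (k + 1) => Series) Series :=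
    LinearMap.uncurryLeft (M := fun _ : Fin (k + 1) => Series)
      { toFun := fun f => ((LinearMap.mulLeft ℤ f).comp D).compMultilinearMap E
        map_add' := fun f g => by ext v; simp [add_mul]
        map_smul' := fun a f => by ext v; simp }
  have hP : ∀ k E v, P k E v = v 0 * delta (E (Fin.tail v)) := fun k E v => rfl
  have key : ∀ k, ∃ E : MultilinearMap ℤ (fun _ : Fin (k + 1) => Series) Series,
      ∀ v, E v = iterRightProd (List.ofFn v) := by
    intro k
    induction k with
    | zero =>
      refine ⟨MultilinearMap.mk' (fun v => v 0) ?_ ?_, fun v => by simp [iterRightProd]⟩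
      · intro v i a b
        obtain rfl : i = 0 := Fin.fin_one_eq_zero i
        simp
      · intro v i a b
        obtain rfl : i = 0 := Fin.fin_one_eq_zero i
        simp
    | succ k ih =>
      obtain ⟨E, hE⟩ := ih
      refine ⟨P _ E, fun v => ?_⟩
      rw [hP, hE]
      simp [iterRightProd, rightProd, List.ofFn_succ, Fin.tail]
  obtain ⟨k, rfl⟩ : ∃ k, m = k + 1 := ⟨m - 1, by lia⟩
  obtain ⟨E, hE⟩ := key k
  refine ⟨(LinearMap.mulLeft ℤ (x * y)).compMultilinearMap (P _ E), fun f g => ?_⟩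
  rw [LinearMap.compMultilinearMap_apply, hP, hE]
  simp only [LinearMap.mulLeft_apply, Fin.cons_zero, Fin.tail_cons, opB, leftProd, rightProd]
  ring

end MTamari

/-!
The level of the point `(a, b)` is `m b - a`. Let `Φ_j` be the generating function of the intervals
of paths that go from level `j` to level `0` through nonnegative levels, where `x` marks the visits
of level `0` by the lower path except the last one; thus `Φ_0` is the series of the theorem.

Removing the initial up step of a nonempty path gives `Φ_0 = 1 + x y Φ_m`. A path from level `j + 1`
splits at its first visit of level `0`. If the upper path of an interval splits as `u 0 v`, then the
lower path also visits level `0` at the end of `u 0`, so that it is `r 0 s t` with `r 0 s ≤ u 0` and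
`t ≤ v`. Moreover `r 0 s ≤ u 0` if and only if `r s ≤ u`, and the latter is an interval from level
`j` with a marked visit of level `0`, between `r` and `s`. Since `Δ(x ^ c) = 1 + x + ⋯ + x ^ c`,
marking a visit amounts to applying `Δ`. Hence `Φ_{j+1} = Φ_0 Δ(Φ_j)`, and `m` such steps turn `Φ_0`
into `Φ_m`.
-/

namespace MTamari

variable {m : ℕ}

/-! ### Paths from a given level -/

/-- Read from level `j`, the word `w` stays at nonnegative levels and ends at level `0`. The level
of the point `(a, b)` is `m b - a`: an up step adds `m` to it, and the other step subtracts `1`. -/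
inductive PathFrom (m : ℕ) : ℕ → List Bool → Prop
  | nil : PathFrom m 0 []
  | up {j : ℕ} {w : List Bool} (h : PathFrom m (j + m) w) : PathFrom m j (true :: w)
  | down {j : ℕ} {w : List Bool} (h : PathFrom m j w) : PathFrom m (j + 1) (false :: w)

@[simp] theorem pathFrom_nil_iff {j : ℕ} : PathFrom m j [] ↔ j = 0 :=
  ⟨fun h => by cases h; rfl, fun h => h ▸ .nil⟩

@[simp] theorem pathFrom_true_cons_iff {j : ℕ} {w : List Bool} :
    PathFrom m j (true :: w) ↔ PathFrom m (j + m) w :=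
  ⟨fun h => by cases h; assumption, .up⟩

@[simp] theorem pathFrom_succ_false_cons_iff {j : ℕ} {w : List Bool} :
    PathFrom m (j + 1) (false :: w) ↔ PathFrom m j w :=
  ⟨fun h => by cases h; assumption, .down⟩

@[simp] theorem not_pathFrom_zero_false_cons {w : List Bool} : ¬ PathFrom m 0 (false :: w) :=
  nofun

namespace PathFrom

theorem count_false {j : ℕ} {w : List Bool} (h : PathFrom m j w) :
    w.count false = j + m * w.count true := by
  induction h with
  | nil => rfl
  | up _ ih =>
    rw [List.count_cons_of_ne (by decide), List.count_cons_self]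
    lia
  | down _ ih =>
    rw [List.count_cons_self, List.count_cons_of_ne (by decide)]
    lia

theorem length_eq {j : ℕ} {w : List Bool} (h : PathFrom m j w) :
    w.length = w.count true + (j + m * w.count true) := by
  rw [← h.count_false, List.count_true_add_count_false]

theorem append_iff {j i : ℕ} {u v : List Bool} (hu : PathFrom m j u) :
    PathFrom m (j + i) (u ++ v) ↔ PathFrom m i v := by
  induction hu with
  | nil => simp
  | up _ ih => simpa [add_right_comm] using ih
  | down _ ih => simpa [add_right_comm] using ih

theorem append_iff_of_zero {i : ℕ} {u v : List Bool} (hu : PathFrom m 0 u) :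
    PathFrom m i (u ++ v) ↔ PathFrom m i v := by
  simpa using hu.append_iff (i := i) (v := v)

theorem append_zero_iff {j : ℕ} {u v : List Bool} (hu : PathFrom m j u) :
    PathFrom m j (u ++ v) ↔ PathFrom m 0 v :=
  hu.append_iff (i := 0)

theorem append_false_iff {j : ℕ} {u v : List Bool} (hu : PathFrom m j u) :
    PathFrom m (j + 1) (u ++ false :: v) ↔ PathFrom m 0 v := by
  rw [hu.append_iff, ← zero_add 1, pathFrom_succ_false_cons_iff]

theorem count_false_le_of_append {j : ℕ} {u v : List Bool} (h : PathFrom m j (u ++ v)) :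
    u.count false ≤ j + m * u.count true := by
  induction u generalizing j with
  | nil => simp
  | cons b u ih =>
    cases h with
    | up h =>
      rw [List.count_cons_of_ne (by decide), List.count_cons_self]
      have := ih h
      lia
    | down h =>
      rw [List.count_cons_self, List.count_cons_of_ne (by decide)]
      have := ih h
      lia

theorem of_append_of_count_false {j : ℕ} {u v : List Bool} (h : PathFrom m j (u ++ v))
    (hu : u.count false = j + m * u.count true) : PathFrom m j u := by
  induction u generalizing j with
  | nil => simpa [eq_comm] using hu
  | cons b u ih =>
    cases h with
    | up h =>
      rw [List.count_cons_of_ne (by decide), List.count_cons_self] at hu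
      exact .up (ih h (by lia))
    | down h =>
      rw [List.count_cons_self, List.count_cons_of_ne (by decide)] at hu
      exact .down (ih h (by lia))

theorem exists_first_return {j : ℕ} {w : List Bool} (h : PathFrom m (j + 1) w) :
    ∃ u v, w = u ++ false :: v ∧ PathFrom m j u ∧ PathFrom m 0 v := by
  induction w generalizing j with
  | nil => simp at h
  | cons b w ih =>
    cases h with
    | up h =>
      obtain ⟨u, v, rfl, hu, hv⟩ := ih (add_right_comm j 1 m ▸ h)
      exact ⟨true :: u, v, rfl, hu.up, hv⟩
    | down h =>
      cases j with
      | zero => exact ⟨[], w, rfl, .nil, h⟩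
      | succ j =>
        obtain ⟨u, v, rfl, hu, hv⟩ := ih h
        exact ⟨false :: u, v, rfl, hu.down, hv⟩

/-- Read from level `j + i`, the word `c` stays at levels at least `i`, while `u` followed by a step
`0` goes below level `i`; hence of these two prefixes of the same word the first is shorter. -/
theorem exists_eq_append {j i : ℕ} {c d u v : List Bool} (hc : PathFrom m j c)
    (hu : PathFrom m (j + i) u) (h : u ++ false :: v = c ++ d) :
    ∃ u', u = c ++ u' ∧ PathFrom m i u' ∧ d = u' ++ false :: v := by
  induction hc generalizing u with
  | nil => exact ⟨u, rfl, by simpa using hu, h.symm⟩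
  | @up j c _ ih =>
    cases u with
    | nil => simp at h
    | cons b u =>
      obtain ⟨rfl, huv⟩ : b = true ∧ u ++ false :: v = c ++ d := by simpa using h
      obtain ⟨u', rfl, hu', hd⟩ := ih (by simpa [add_right_comm] using hu) huv
      exact ⟨u', rfl, hu', hd⟩
  | @down j c _ ih =>
    cases u with
    | nil => simp at hu
    | cons b u =>
      obtain ⟨rfl, huv⟩ : b = false ∧ u ++ false :: v = c ++ d := by simpa using h
      obtain ⟨u', rfl, hu', hd⟩ := ih (by simpa [add_right_comm] using hu) huv
      exact ⟨u', rfl, hu', hd⟩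

theorem first_return_unique {j : ℕ} {u v u' v' : List Bool} (hu : PathFrom m j u)
    (hu' : PathFrom m j u') (h : u ++ false :: v = u' ++ false :: v') : u = u' ∧ v = v' := by
  obtain ⟨t, rfl, ht, h'⟩ := exists_eq_append (i := 0) hu' hu h
  cases ht with
  | nil => simpa using h'.symm
  | up => simp at h'

end PathFrom

theorem pathFrom_of_count {j : ℕ} {w : List Bool} (hw : w.count false = j + m * w.count true)
    (hle : ∀ k ≤ w.length, (w.take k).count false ≤ j + m * (w.take k).count true) :
    PathFrom m j w := by
  induction w generalizing j with
  | nil => simpa [eq_comm] using hw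
  | cons b w ih =>
    have hle' (k : ℕ) (hk : k ≤ w.length) := hle (k + 1) (Nat.succ_le_succ hk)
    match b, j with
    | true, j =>
      simp only [List.take_succ_cons, List.count_cons_self, ne_eq, reduceCtorEq, not_false_eq_true,
        List.count_cons_of_ne] at hw hle'
      exact .up (ih (by lia) fun k hk => by have := hle' k hk; lia)
    | false, 0 => simpa using hle 1 (by simp)
    | false, j + 1 =>
      simp only [List.take_succ_cons, List.count_cons_self, ne_eq, reduceCtorEq, not_false_eq_true,
        List.count_cons_of_ne] at hw hle'
      exact .down (ih (by lia) fun k hk => by have := hle' k hk; lia)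

theorem isBallotPath_iff {n : ℕ} {w : List Bool} :
    IsBallotPath m n w ↔ PathFrom m 0 w ∧ w.count true = n := by
  constructor
  · rintro ⟨rfl, hw, hle⟩
    exact ⟨pathFrom_of_count (by simpa using hw) (by simpa using hle), rfl⟩
  · rintro ⟨hw, rfl⟩
    refine ⟨rfl, by simpa using hw.count_false, fun k _ => ?_⟩
    rw [← List.take_append_drop k w] at hw
    simpa using hw.count_false_le_of_append

/-! ### The order on words -/

/-- A step `0` is exchanged with the path `c` from level `0` that follows it. As a nonempty `c` is a
product of primitive paths, a slide is a sequence of rotations; allowing any `c` makes slides stable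
under cutting and gluing. -/
inductive Slide (m : ℕ) : List Bool → List Bool → Prop
  | swap {c : List Bool} (b : List Bool) (hc : PathFrom m 0 c) :
    Slide m (false :: (c ++ b)) (c ++ false :: b)
  | cons (e : Bool) {v w : List Bool} (h : Slide m v w) : Slide m (e :: v) (e :: w)

/-- The reflexive and transitive closure of `Slide`: the `m`-Tamari order extended to words. -/
def WordLE (m : ℕ) : List Bool → List Bool → Prop :=
  Relation.ReflTransGen (Slide m)

namespace Slide

theorem append_left {v w : List Bool} (u : List Bool) (h : Slide m v w) :
    Slide m (u ++ v) (u ++ w) := by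
  induction u with
  | nil => exact h
  | cons e u ih => exact .cons e ih

theorem append_right {v w : List Bool} (h : Slide m v w) (u : List Bool) :
    Slide m (v ++ u) (w ++ u) := by
  induction h with
  | swap b hc => simpa using swap (b ++ u) hc
  | cons e _ ih => exact .cons e ih

theorem exists_eq_append {v w : List Bool} (h : Slide m v w) :
    ∃ a c b, PathFrom m 0 c ∧ v = a ++ [false] ++ c ++ b ∧ w = a ++ c ++ [false] ++ b := by
  induction h with
  | @swap c b hc => exact ⟨[], c, b, hc, by simp, by simp⟩
  | cons e _ ih =>
    obtain ⟨a, c, b, hc, rfl, rfl⟩ := ih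
    exact ⟨e :: a, c, b, hc, by simp, by simp⟩

theorem perm {v w : List Bool} (h : Slide m v w) : v.Perm w := by
  induction h with
  | swap _ _ => exact List.perm_middle.symm
  | cons e _ ih => exact ih.cons e

theorem pathFrom {j : ℕ} {v w : List Bool} (h : Slide m v w) (hv : PathFrom m j v) :
    PathFrom m j w := by
  induction h generalizing j with
  | swap b hc =>
    cases hv with
    | down hv => exact hc.append_iff_of_zero.2 (hc.append_iff_of_zero.1 hv).down
  | cons e _ ih =>
    cases hv with
    | up hv => exact (ih hv).up
    | down hv => exact (ih hv).down

/-- The lower path touches level `0` wherever the upper path does. -/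
theorem exists_append {j : ℕ} {p u v : List Bool} (h : Slide m p (u ++ v)) (hp : PathFrom m j p)
    (hu : PathFrom m j u) :
    ∃ p₁ p₂, p = p₁ ++ p₂ ∧ PathFrom m j p₁ ∧ WordLE m p₁ u ∧ WordLE m p₂ v := by
  generalize hq : u ++ v = q at h
  induction h generalizing j u with
  | @swap c b hc =>
    cases hp with
    | @down j _ hp =>
      obtain ⟨a, d, rfl, ha, -⟩ := hu.exists_first_return
      obtain ⟨a', rfl, -, hb⟩ :=
        hc.exists_eq_append (i := j) (v := d ++ v) (by simpa using ha) (by simpa using hq)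
      obtain ⟨t, ht, rfl⟩ : ∃ t, a' ++ false :: d = false :: t ∧ b = t ++ v := by
        cases a' with
        | nil => exact ⟨d, rfl, by simpa using hb⟩
        | cons e a' =>
          obtain ⟨rfl, rfl⟩ : false = e ∧ b = a' ++ false :: (d ++ v) := by simpa using hb
          exact ⟨a' ++ false :: d, rfl, by simp⟩
      rw [List.append_assoc, ht] at hu ⊢
      have ht' := pathFrom_succ_false_cons_iff.1 (hc.append_iff_of_zero.1 hu)
      exact ⟨false :: (c ++ t), v, by simp, (hc.append_iff_of_zero.2 ht').down,
        .single (.swap t hc), .refl⟩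
  | @cons e p q h ih =>
    cases u with
    | nil =>
      cases hu
      obtain rfl : v = e :: q := hq
      exact ⟨[], e :: p, rfl, .nil, .refl, .single (.cons e h)⟩
    | cons e' u =>
      obtain ⟨rfl, rfl⟩ : e' = e ∧ u ++ v = q := by simpa using hq
      cases hu with
      | up hu =>
        obtain ⟨p₁, p₂, rfl, hp₁, h₁, h₂⟩ := ih (pathFrom_true_cons_iff.1 hp) hu rfl
        exact ⟨true :: p₁, p₂, rfl, hp₁.up, h₁.lift _ fun _ _ => .cons true, h₂⟩
      | down hu =>
        obtain ⟨p₁, p₂, rfl, hp₁, h₁, h₂⟩ := ih (pathFrom_succ_false_cons_iff.1 hp) hu rfl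
        exact ⟨false :: p₁, p₂, rfl, hp₁.down, h₁.lift _ fun _ _ => .cons false, h₂⟩

/-- Erasing the step that first leads to level `0` is monotone. -/
theorem exists_first_return {j : ℕ} {r s q : List Bool} (h : Slide m (r ++ false :: s) q)
    (hr : PathFrom m j r) :
    ∃ r' s', q = r' ++ false :: s' ∧ PathFrom m j r' ∧ WordLE m (r ++ s) (r' ++ s') := by
  induction hr generalizing q with
  | nil =>
    cases h with
    | swap b hc => exact ⟨_, b, rfl, hc, .refl⟩
    | cons _ h => exact ⟨[], _, rfl, .nil, .single h⟩
  | up _ ih =>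
    cases h with
    | cons _ h =>
      obtain ⟨r', s', rfl, hr', hle⟩ := ih h
      exact ⟨true :: r', s', rfl, hr'.up, hle.lift _ fun _ _ => .cons true⟩
  | @down j r hr ih =>
    rw [List.cons_append] at h
    generalize hv : r ++ false :: s = v at h
    cases h with
    | @swap c b hc =>
      obtain ⟨r', rfl, hr', rfl⟩ := hc.exists_eq_append (i := j) (by simpa using hr) hv
      refine ⟨c ++ false :: r', s, by simp, hc.append_iff_of_zero.2 hr'.down, ?_⟩
      simpa [WordLE] using Relation.ReflTransGen.single (Slide.swap (r' ++ s) hc)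
    | cons _ h =>
      subst hv
      obtain ⟨r', s', rfl, hr', hle⟩ := ih h
      exact ⟨false :: r', s', rfl, hr'.down, hle.lift _ fun _ _ => .cons false⟩

end Slide

namespace WordLE

theorem append {v w v' w' : List Bool} (h : WordLE m v w) (h' : WordLE m v' w') :
    WordLE m (v ++ v') (w ++ w') :=
  Relation.ReflTransGen.trans (h.lift (· ++ v') fun _ _ h => h.append_right v')
    (h'.lift (w ++ ·) fun _ _ h => h.append_left w)

theorem cons {v w : List Bool} (e : Bool) (h : WordLE m v w) : WordLE m (e :: v) (e :: w) :=
  append (v := [e]) .refl h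

theorem perm {v w : List Bool} (h : WordLE m v w) : v.Perm w := by
  induction h with
  | refl => exact .refl _
  | tail _ h ih => exact ih.trans h.perm

theorem pathFrom {j : ℕ} {v w : List Bool} (h : WordLE m v w) (hv : PathFrom m j v) :
    PathFrom m j w := by
  induction h with
  | refl => exact hv
  | tail _ h ih => exact h.pathFrom ih

theorem exists_of_true_cons {v w : List Bool} (h : WordLE m (true :: v) w) :
    ∃ w', w = true :: w' ∧ WordLE m v w' := by
  induction h with
  | refl => exact ⟨v, rfl, .refl⟩
  | tail _ h ih =>
    obtain ⟨u, rfl, hu⟩ := ih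
    cases h with
    | cons _ h => exact ⟨_, rfl, hu.tail h⟩

theorem exists_append {j : ℕ} {p u v : List Bool} (h : WordLE m p (u ++ v))
    (hp : PathFrom m j p) (hu : PathFrom m j u) :
    ∃ p₁ p₂, p = p₁ ++ p₂ ∧ PathFrom m j p₁ ∧ WordLE m p₁ u ∧ WordLE m p₂ v := by
  induction h using Relation.ReflTransGen.head_induction_on with
  | refl => exact ⟨u, v, rfl, hu, .refl, .refl⟩
  | head h _ ih =>
    obtain ⟨q₁, q₂, rfl, hq₁, hu, hv⟩ := ih (h.pathFrom hp)
    obtain ⟨p₁, p₂, rfl, hp₁, h₁, h₂⟩ := h.exists_append hp hq₁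
    exact ⟨p₁, p₂, rfl, hp₁, h₁.trans hu, h₂.trans hv⟩

theorem exists_first_return {j : ℕ} {r s q : List Bool} (h : WordLE m (r ++ false :: s) q)
    (hr : PathFrom m j r) :
    ∃ r' s', q = r' ++ false :: s' ∧ PathFrom m j r' ∧ WordLE m (r ++ s) (r' ++ s') := by
  induction h with
  | refl => exact ⟨r, s, rfl, hr, .refl⟩
  | tail _ h ih =>
    obtain ⟨r₁, s₁, rfl, hr₁, h₁⟩ := ih
    obtain ⟨r₂, s₂, rfl, hr₂, h₂⟩ := h.exists_first_return hr₁
    exact ⟨r₂, s₂, rfl, hr₂, h₁.trans h₂⟩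

end WordLE

theorem wordLE_append_false_iff {j : ℕ} {r s u : List Bool} (hr : PathFrom m j r)
    (hs : PathFrom m 0 s) (hu : PathFrom m j u) :
    WordLE m (r ++ false :: s) (u ++ [false]) ↔ WordLE m (r ++ s) u := by
  constructor
  · intro h
    obtain ⟨r', s', h₁, hr', h₂⟩ := h.exists_first_return hr
    obtain ⟨rfl, rfl⟩ := hu.first_return_unique hr' h₁
    simpa using h₂
  · intro h
    have hslide : Slide m (r ++ false :: s) (r ++ s ++ [false]) := by
      simpa using (Slide.swap [] hs).append_left r
    exact .head hslide (h.append .refl)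

/-! ### Comparison with ballot paths and rotations -/

theorem WordLE.isBallotPath {n : ℕ} {v w : List Bool} (h : WordLE m v w)
    (hv : IsBallotPath m n v) : IsBallotPath m n w := by
  rw [isBallotPath_iff] at hv ⊢
  exact ⟨h.pathFrom hv.1, h.perm.count_eq true ▸ hv.2⟩

theorem PathFrom.exists_primitive {c : List Bool} (hc : PathFrom m 0 c) (hne : c ≠ []) :
    ∃ c₁ c₂, c = c₁ ++ c₂ ∧ IsPrimitive m c₁ ∧ PathFrom m 0 c₁ ∧ PathFrom m 0 c₂ := by
  have hex : ∃ k, 0 < k ∧ TouchesAt m c k :=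
    ⟨c.length, List.length_pos_iff.2 hne, by simpa [TouchesAt] using hc.count_false⟩
  classical
  obtain ⟨hk₀, hk⟩ := Nat.find_spec hex
  set k := Nat.find hex
  rw [← List.take_append_drop k c] at hc
  have hc₁ := hc.of_append_of_count_false (by simpa [TouchesAt] using hk)
  refine ⟨c.take k, c.drop k, (List.take_append_drop k c).symm, ⟨by simp [hk₀.ne', hne],
    ⟨_, isBallotPath_iff.2 ⟨hc₁, rfl⟩⟩, fun i hi hik htouch => ?_⟩, hc₁, hc₁.append_zero_iff.1 hc⟩
  have hik : i < k := hik.trans_le (List.length_take_le k c)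
  refine Nat.find_min hex hik ⟨hi, ?_⟩
  rwa [TouchesAt, List.take_take, min_eq_left hik.le] at htouch

theorem Rotation.slide {n : ℕ} {p q : BallotPath m n} (h : Rotation p q) : Slide m p.1 q.1 := by
  obtain ⟨a, c, b, ⟨-, ⟨k, hc⟩, -⟩, hp, hq⟩ := h
  rw [hp, hq]
  simpa using (Slide.swap b (isBallotPath_iff.1 hc).1).append_left a

theorem Slide.le {n : ℕ} {p q : BallotPath m n} (h : Slide m p.1 q.1) : p ≤ q := by
  obtain ⟨a, c, b, hc, hp, hq⟩ := h.exists_eq_append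
  clear h
  induction hl : c.length using Nat.strong_induction_on generalizing a c p with
  | _ l ih =>
    rcases eq_or_ne c [] with rfl | hne
    · exact le_of_eq (Subtype.ext (by simp [hp, hq]))
    obtain ⟨c₁, c₂, rfl, hprim, hc₁, hc₂⟩ := hc.exists_primitive hne
    have hslide : Slide m p.1 (a ++ c₁ ++ [false] ++ c₂ ++ b) := by
      simpa [hp] using (Slide.swap (c₂ ++ b) hc₁).append_left a
    let p' : BallotPath m n := ⟨_, WordLE.isBallotPath (.single hslide) p.2⟩
    have hrotation : Rotation p p' := ⟨a, c₁, c₂ ++ b, hprim, by simp [hp], by simp [p']⟩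
    have hlt : c₂.length < l := by
      simpa [← hl] using List.length_pos_iff.2 hprim.1
    exact .head hrotation (ih c₂.length hlt (a ++ c₁) c₂ hc₂ rfl (by simp [hq]) rfl)

theorem ballotPath_le_iff_wordLE {n : ℕ} {p q : BallotPath m n} : p ≤ q ↔ WordLE m p.1 q.1 := by
  constructor
  · intro (h : Relation.ReflTransGen Rotation p q)
    exact h.lift Subtype.val fun _ _ => Rotation.slide
  intro h
  obtain ⟨w, hw⟩ := q
  change WordLE m p.1 w at h
  induction h with
  | refl => exact le_rfl
  | tail h h' ih =>
    have hv := WordLE.isBallotPath h p.2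
    exact (ih hv).trans (Slide.le (p := ⟨_, hv⟩) h')

/-! ### Contacts -/

/-- The number of nonempty suffixes of `w` going from level `0` to level `0`. For a path ending at
level `0`, these are the visits of level `0` except the last one; no starting level is needed. -/
def suffixContacts (m : ℕ) : List Bool → ℕ
  | [] => 0
  | e :: w =>
    (if (e :: w).count false = m * (e :: w).count true then 1 else 0) + suffixContacts m w

theorem suffixContacts_eq_card (w : List Bool) :
    suffixContacts m w = ((Finset.range w.length).filter fun k =>
      (w.drop k).count false = m * (w.drop k).count true).card := by
  induction w with
  | nil => rfl
  | cons e w ih =>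
    rw [suffixContacts, ih, Finset.card_filter, Finset.card_filter, List.length_cons,
      Finset.sum_range_succ', add_comm]
    rfl

theorem suffixContacts_append {u v : List Bool} (hv : PathFrom m 0 v) :
    suffixContacts m (u ++ v) = suffixContacts m u + suffixContacts m v := by
  induction u with
  | nil => simp [suffixContacts]
  | cons e u ih =>
    have hcount : (e :: (u ++ v)).count false = m * (e :: (u ++ v)).count true ↔
        (e :: u).count false = m * (e :: u).count true := by
      rw [← List.cons_append, List.count_append, List.count_append, hv.count_false]
      lia
    rw [List.cons_append, suffixContacts, suffixContacts, ih, add_assoc]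
    simp only [hcount]

namespace PathFrom

theorem suffixContacts_cons {j : ℕ} {e : Bool} {w : List Bool} (h : PathFrom m j (e :: w)) :
    suffixContacts m (e :: w) = (if j = 0 then 1 else 0) + suffixContacts m w := by
  rw [suffixContacts, h.count_false]
  simp

theorem suffixContacts_append_false {j : ℕ} {u v : List Bool} (hu : PathFrom m j u)
    (hv : PathFrom m 0 v) : suffixContacts m (u ++ false :: v) = suffixContacts m v := by
  have h := hu.append_false_iff.2 hv
  induction hu with
  | nil => simp [h.suffixContacts_cons]
  | up hu ih =>
    refine h.suffixContacts_cons.trans ?_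
    simpa using ih (hu.append_false_iff.2 hv)
  | down hu ih =>
    refine h.suffixContacts_cons.trans ?_
    simpa using ih (hu.append_false_iff.2 hv)

theorem contacts_eq {w : List Bool} (hw : PathFrom m 0 w) :
    contacts m w = suffixContacts m w := by
  have htouch (k : ℕ) :
      TouchesAt m w k ↔ (w.drop k).count false = m * (w.drop k).count true := by
    have hcount := hw.count_false
    rw [← List.take_append_drop k w, List.count_append, List.count_append] at hcount
    rw [TouchesAt]
    lia
  rw [suffixContacts_eq_card, contacts]
  simp only [← htouch, Finset.card_filter]
  have hstart : TouchesAt m w 0 := by simp [TouchesAt]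
  have hend : TouchesAt m w w.length := by simpa [TouchesAt] using hw.count_false
  have hsum := Finset.sum_range_succ (fun k => if TouchesAt m w k then 1 else 0) w.length
  rw [Finset.sum_range_succ', if_pos hstart, if_pos hend] at hsum
  rw [← Finset.Ico_add_one_right_eq_Icc, Finset.sum_Ico_eq_sum_range]
  simpa [add_comm 1] using hsum

theorem eq_nil_of_suffixContacts_eq_zero {w : List Bool} (hw : PathFrom m 0 w)
    (h : suffixContacts m w = 0) : w = [] := by
  cases w with
  | nil => rfl
  | cons e w => simp [hw.suffixContacts_cons] at h

theorem exists_cut {j i : ℕ} {w : List Bool} (hw : PathFrom m j w) (hi : i ≤ suffixContacts m w) :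
    ∃ r s, w = r ++ s ∧ PathFrom m j r ∧ PathFrom m 0 s ∧ suffixContacts m s = i := by
  induction hw with
  | nil => exact ⟨[], [], rfl, .nil, .nil, by simpa [suffixContacts, eq_comm] using hi⟩
  | @up j w hw ih =>
    by_cases hcut : j = 0 ∧ i = suffixContacts m (true :: w)
    · obtain ⟨rfl, rfl⟩ := hcut
      exact ⟨[], true :: w, rfl, .nil, hw.up, rfl⟩
    · obtain ⟨r, s, rfl, hr, hs, hsi⟩ := ih (by
        have := hw.up.suffixContacts_cons
        split_ifs at this <;> lia)
      exact ⟨true :: r, s, rfl, hr.up, hs, hsi⟩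
  | @down j w hw ih =>
    obtain ⟨r, s, rfl, hr, hs, hsi⟩ := ih (by simpa [hw.down.suffixContacts_cons] using hi)
    exact ⟨false :: r, s, rfl, hr.down, hs, hsi⟩

theorem cut_unique {j : ℕ} {r s r' s' : List Bool} (hr : PathFrom m j r) (hs : PathFrom m 0 s)
    (hr' : PathFrom m j r') (hs' : PathFrom m 0 s') (h : r ++ s = r' ++ s')
    (hcontacts : suffixContacts m s = suffixContacts m s') : r = r' ∧ s = s' := by
  wlog hprefix : ∃ t, r' = r ++ t ∧ s = t ++ s' generalizing r s r' s'
  · rcases List.append_eq_append_iff.1 h with ht | ht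
    · exact this hr hs hr' hs' h hcontacts ht
    · exact (this hr' hs' hr hs h.symm hcontacts.symm ht).imp Eq.symm Eq.symm
  obtain ⟨t, rfl, rfl⟩ := hprefix
  obtain rfl : t = [] := (hr.append_zero_iff.1 hr').eq_nil_of_suffixContacts_eq_zero (by
    rw [suffixContacts_append hs'] at hcontacts
    lia)
  simp

end PathFrom

/-! ### Generating functions -/

section GenSeries

variable {α β : Type*}

/-- The generating function `∑ x ^ weight a * y ^ size a` of a type with finitely many elements of
each size. If some size has infinitely many elements, its coefficient has no meaning. -/
noncomputable def genSeries (size weight : α → ℕ) : Series :=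
  PowerSeries.mk fun n => ∑ᶠ a ∈ size ⁻¹' {n}, Polynomial.X ^ weight a

theorem genSeries_eq_of_bijective {size weight : α → ℕ} {size' weight' : β → ℕ} {f : α → β}
    (hf : f.Bijective) (hsize : ∀ a, size' (f a) = size a)
    (hweight : ∀ a, weight' (f a) = weight a) :
    genSeries size weight = genSeries size' weight' := by
  ext1 n
  simp only [genSeries, PowerSeries.coeff_mk]
  refine finsum_mem_eq_of_bijOn f ⟨fun a ha => by simpa [hsize] using ha, hf.1.injOn, ?_⟩
    fun a _ => by rw [hweight]
  intro b hb
  obtain ⟨a, rfl⟩ := hf.2 b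
  exact ⟨a, by simpa [hsize] using hb, rfl⟩

theorem coeff_genSeries {size weight : α → ℕ} {n : ℕ} {t : Finset α}
    (ht : ∀ a, a ∈ t ↔ size a = n) :
    PowerSeries.coeff n (genSeries size weight) = ∑ a ∈ t, Polynomial.X ^ weight a := by
  have hfiber : size ⁻¹' {n} = t := by
    ext a
    simp [ht]
  rw [genSeries, PowerSeries.coeff_mk, hfiber, finsum_mem_coe_finset]

theorem genSeries_unit : genSeries (fun _ : Unit => 0) (fun _ => 0) = 1 := by
  ext1 n
  rw [coeff_genSeries (t := if n = 0 then {()} else ∅) (by aesop), PowerSeries.coeff_one]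
  split_ifs <;> simp

theorem genSeries_sumElim {size weight : α → ℕ} {size' weight' : β → ℕ}
    (hα : ∀ n, (size ⁻¹' {n}).Finite) (hβ : ∀ n, (size' ⁻¹' {n}).Finite) :
    genSeries (Sum.elim size size') (Sum.elim weight weight') =
      genSeries size weight + genSeries size' weight' := by
  ext1 n
  rw [map_add, coeff_genSeries (t := (hα n).toFinset) (by simp),
    coeff_genSeries (t := (hβ n).toFinset) (by simp),
    coeff_genSeries (t := (hα n).toFinset.disjSum (hβ n).toFinset) (by simp), Finset.sum_disjSum]
  rfl

theorem genSeries_add_one {size weight : α → ℕ} (hα : ∀ n, (size ⁻¹' {n}).Finite) :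
    genSeries (fun a => size a + 1) (fun a => weight a + 1) = x * y * genSeries size weight := by
  ext1 n
  rw [mul_assoc, x, PowerSeries.coeff_C_mul, y]
  cases n with
  | zero => simp [coeff_genSeries (t := ∅)]
  | succ n =>
    rw [PowerSeries.coeff_succ_X_mul, coeff_genSeries (t := (hα n).toFinset) (by simp),
      coeff_genSeries (t := (hα n).toFinset) (by simp), Finset.mul_sum]
    simp only [pow_succ']

theorem genSeries_prod {size weight : α → ℕ} {size' weight' : β → ℕ}
    (hα : ∀ n, (size ⁻¹' {n}).Finite) (hβ : ∀ n, (size' ⁻¹' {n}).Finite) :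
    genSeries (fun p : α × β => size p.1 + size' p.2) (fun p => weight p.1 + weight' p.2) =
      genSeries size weight * genSeries size' weight' := by
  classical
  ext1 n
  rw [PowerSeries.coeff_mul,
    coeff_genSeries (t := (Finset.HasAntidiagonal.antidiagonal n).biUnion fun ij =>
      (hα ij.1).toFinset ×ˢ (hβ ij.2).toFinset) (by simp),
    Finset.sum_biUnion]
  · refine Finset.sum_congr rfl fun ij _ => ?_
    rw [coeff_genSeries (t := (hα ij.1).toFinset) (by simp),
      coeff_genSeries (t := (hβ ij.2).toFinset) (by simp), Finset.sum_mul_sum, Finset.sum_product]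
    simp only [pow_add]
  · refine fun ij _ kl _ hne => Finset.disjoint_left.2 fun p hp hp' => hne ?_
    simp only [Finset.mem_product, Set.Finite.mem_toFinset, Set.mem_preimage,
      Set.mem_singleton_iff] at hp hp'
    exact Prod.ext (hp.1.symm.trans hp'.1) (hp.2.symm.trans hp'.2)

theorem polyDelta_X_pow (c : ℕ) :
    polyDelta (Polynomial.X ^ c) = ∑ i ∈ Finset.range (c + 1), Polynomial.X ^ i := by
  apply mul_left_cancel₀ (Polynomial.X_sub_C_ne_zero (1 : ℤ))
  rw [map_one, sub_one_mul_polyDelta, mul_comm (_ - _), geom_sum_mul]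
  simp [pow_succ']

theorem polyDelta_sum {ι : Type*} (s : Finset ι) (p : ι → Polynomial ℤ) :
    polyDelta (∑ i ∈ s, p i) = ∑ i ∈ s, polyDelta (p i) :=
  map_sum (AddMonoidHom.mk' polyDelta polyDelta_add) p s

theorem delta_genSeries {size weight : α → ℕ} (hα : ∀ n, (size ⁻¹' {n}).Finite) :
    delta (genSeries size weight) =
      genSeries (fun p : (a : α) × Fin (weight a + 1) => size p.1) fun p => (p.2 : ℕ) := by
  ext1 n
  rw [delta, PowerSeries.coeff_mk, coeff_genSeries (t := (hα n).toFinset) (by simp), polyDelta_sum,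
    coeff_genSeries (t := (hα n).toFinset.sigma fun _ => Finset.univ) (by simp), Finset.sum_sigma]
  simp only [polyDelta_X_pow, Finset.sum_range]

end GenSeries

/-! ### Intervals of paths from a given level -/

/-- An interval of the `m`-Tamari order on paths from level `j` to level `0`. -/
@[ext]
structure LevelInterval (m j : ℕ) where
  lower : List Bool
  upper : List Bool
  lower_path : PathFrom m j lower
  le : WordLE m lower upper

/-- An interval of paths from level `j`, with a marked visit of level `0` by the lower path
`r ++ s`: the one between `r` and `s`. -/
@[ext]
structure MarkedInterval (m j : ℕ) where
  r : List Bool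
  s : List Bool
  upper : List Bool
  r_path : PathFrom m j r
  s_path : PathFrom m 0 s
  le : WordLE m (r ++ s) upper

/-- The generating function of intervals of paths from level `j`: `y` marks the number of up steps
and `x` the visits of level `0` by the lower path, except the last one. -/
noncomputable def levelSeries (m j : ℕ) : Series :=
  genSeries (fun I : LevelInterval m j => I.lower.count true) fun I => suffixContacts m I.lower

namespace LevelInterval

variable {j : ℕ}

theorem upper_path (I : LevelInterval m j) : PathFrom m j I.upper :=
  I.le.pathFrom I.lower_path

theorem finite_count_eq (n : ℕ) :
    ((fun I : LevelInterval m j => I.lower.count true) ⁻¹' {n}).Finite := by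
  have hwords := List.finite_length_eq Bool (n + (j + m * n))
  refine ((hwords.prod hwords).preimage (f := fun I => (I.lower, I.upper))
    fun I _ I' _ h => LevelInterval.ext (congrArg Prod.fst h) (congrArg Prod.snd h)).subset ?_
  rintro I rfl
  have hlength := I.lower_path.length_eq
  exact ⟨hlength, I.le.perm.length_eq.symm.trans hlength⟩

/-- The interval of the empty path. -/
def nil : LevelInterval m 0 := ⟨[], [], .nil, .refl⟩

/-- Both paths of the interval are preceded by an up step. -/
def consUp (I : LevelInterval m m) : LevelInterval m 0 :=
  ⟨true :: I.lower, true :: I.upper, .up (by simpa using I.lower_path), I.le.cons true⟩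

theorem bijective_elim_nil_consUp :
    (Sum.elim (fun _ => nil) consUp : Unit ⊕ LevelInterval m m → LevelInterval m 0).Bijective := by
  constructor
  · rintro (_ | I) (_ | I') h
    · rfl
    · cases h
    · cases h
    · simpa [consUp, LevelInterval.ext_iff] using h
  · rintro ⟨lower, upper, hlower, hle⟩
    cases hlower with
    | nil => exact ⟨.inl (), LevelInterval.ext rfl hle.perm.nil_eq⟩
    | up hlower =>
      obtain ⟨upper, rfl, hle'⟩ := hle.exists_of_true_cons
      exact ⟨.inr ⟨_, upper, by simpa using hlower, hle'⟩, rfl⟩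

end LevelInterval

namespace MarkedInterval

variable {j : ℕ}

theorem upper_path (M : MarkedInterval m j) : PathFrom m j M.upper :=
  M.le.pathFrom (M.r_path.append_zero_iff.2 M.s_path)

/-- The interval together with the number of visits of level `0` from the marked one on, except the
last one. -/
def toSigma (M : MarkedInterval m j) :
    (I : LevelInterval m j) × Fin (suffixContacts m I.lower + 1) :=
  ⟨⟨M.r ++ M.s, M.upper, M.r_path.append_zero_iff.2 M.s_path, M.le⟩, suffixContacts m M.s,
    by rw [suffixContacts_append M.s_path]; lia⟩

theorem bijective_toSigma : (toSigma : MarkedInterval m j → _).Bijective := by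
  constructor
  · intro M M' h
    have hlower : M.r ++ M.s = M'.r ++ M'.s := congrArg (fun p => p.1.lower) h
    have hupper : M.upper = M'.upper := congrArg (fun p => p.1.upper) h
    have hmark : suffixContacts m M.s = suffixContacts m M'.s := congrArg (fun p => (p.2 : ℕ)) h
    obtain ⟨hr, hs⟩ := M.r_path.cut_unique M.s_path M'.r_path M'.s_path hlower hmark
    exact MarkedInterval.ext hr hs hupper
  · rintro ⟨⟨lower, upper, hlower, hle⟩, i, hi⟩
    obtain ⟨r, s, rfl, hr, hs, rfl⟩ := hlower.exists_cut (Nat.lt_succ_iff.1 hi)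
    exact ⟨⟨r, s, upper, hr, hs, hle⟩, rfl⟩

theorem finite_count_eq (n : ℕ) :
    ((fun M : MarkedInterval m j => (M.r ++ M.s).count true) ⁻¹' {n}).Finite := by
  refine Set.Finite.preimage (f := toSigma) (bijective_toSigma.1.injOn)
    (s := (fun p => p.1.lower.count true) ⁻¹' {n}) ?_
  exact (LevelInterval.finite_count_eq n).preimage' (f := Sigma.fst) fun I _ =>
    (Set.finite_range (Sigma.mk I)).subset (by rintro ⟨I, i⟩ rfl; exact ⟨i, rfl⟩)

theorem genSeries_eq_delta :
    genSeries (fun M : MarkedInterval m j => (M.r ++ M.s).count true)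
      (fun M => suffixContacts m M.s) = delta (levelSeries m j) := by
  rw [levelSeries, delta_genSeries LevelInterval.finite_count_eq]
  exact genSeries_eq_of_bijective bijective_toSigma (fun _ => rfl) fun _ => rfl

/-- The lower path `r ++ s` gets an extra step `0` at the mark, the upper path one at its end, and
both are followed by the paths of an interval from level `0`. -/
def glue (p : LevelInterval m 0 × MarkedInterval m j) : LevelInterval m (j + 1) where
  lower := p.2.r ++ false :: (p.2.s ++ p.1.lower)
  upper := p.2.upper ++ false :: p.1.upper
  lower_path := p.2.r_path.append_false_iff.2 (p.2.s_path.append_zero_iff.2 p.1.lower_path)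
  le := by
    have h := (wordLE_append_false_iff p.2.r_path p.2.s_path p.2.upper_path).2 p.2.le
    simpa using h.append p.1.le

theorem injective_glue : (glue : LevelInterval m 0 × MarkedInterval m j → _).Injective := by
  rintro ⟨I, M⟩ ⟨I', M'⟩ h
  have hlower : M.r ++ false :: (M.s ++ I.lower) = M'.r ++ false :: (M'.s ++ I'.lower) :=
    congrArg LevelInterval.lower h
  have hupper : M.upper ++ false :: I.upper = M'.upper ++ false :: I'.upper :=
    congrArg LevelInterval.upper h
  obtain ⟨hr, hs⟩ := M.r_path.first_return_unique M'.r_path hlower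
  obtain ⟨hM, hI⟩ := M.upper_path.first_return_unique M'.upper_path hupper
  have hlength : I.lower.length = I'.lower.length := by
    rw [I.le.perm.length_eq, hI, I'.le.perm.length_eq]
  obtain ⟨hs, ht⟩ := List.append_inj' hs hlength
  exact Prod.ext (LevelInterval.ext ht hI) (MarkedInterval.ext hr hs hM)

theorem surjective_glue : (glue : LevelInterval m 0 × MarkedInterval m j → _).Surjective := by
  intro I
  obtain ⟨u, v, hupper, hu, -⟩ := I.upper_path.exists_first_return
  have hu' : PathFrom m (j + 1) (u ++ [false]) := hu.append_false_iff.2 .nil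
  obtain ⟨p, t, hlower, hp, hpu, htv⟩ :=
    WordLE.exists_append (v := v) (by simpa [hupper] using I.le) I.lower_path hu'
  obtain ⟨r, s, rfl, hr, hs⟩ := hp.exists_first_return
  have ht : PathFrom m 0 t := hp.append_zero_iff.1 (hlower ▸ I.lower_path)
  refine ⟨(⟨t, v, ht, htv⟩, ⟨r, s, u, hr, hs, (wordLE_append_false_iff hr hs hu).1 hpu⟩), ?_⟩
  exact LevelInterval.ext (by simp [glue, hlower]) (by simp [glue, hupper])

end MarkedInterval

/-! ### The functional equation -/

theorem intervalSeries_eq_levelSeries (m : ℕ) : intervalSeries m = levelSeries m 0 := by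
  let f (n : ℕ) (I : TamariInterval m n) : LevelInterval m 0 :=
    ⟨I.1.1.1, I.1.2.1, (isBallotPath_iff.1 I.1.1.2).1, ballotPath_le_iff_wordLE.1 I.2⟩
  ext1 n
  rw [intervalSeries, PowerSeries.coeff_mk, levelSeries, genSeries, PowerSeries.coeff_mk,
    ← finsum_eq_sum_of_fintype, ← finsum_mem_univ]
  refine finsum_mem_eq_of_bijOn (f n) ⟨fun I _ => I.1.1.2.1, fun I _ I' _ h => ?_, fun I hI => ?_⟩
    fun I _ => by rw [(isBallotPath_iff.1 I.1.1.2).1.contacts_eq]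
  · exact Subtype.ext (Prod.ext (Subtype.ext (congrArg LevelInterval.lower h))
      (Subtype.ext (congrArg LevelInterval.upper h)))
  · have hlower : IsBallotPath m n I.lower := isBallotPath_iff.2 ⟨I.lower_path, hI⟩
    exact ⟨⟨(⟨_, hlower⟩, ⟨_, I.le.isBallotPath hlower⟩), ballotPath_le_iff_wordLE.2 I.le⟩,
      trivial, rfl⟩

theorem levelSeries_zero (m : ℕ) : levelSeries m 0 = x * y * levelSeries m m + 1 := by
  have hfinite := LevelInterval.finite_count_eq (m := m) (j := m)
  rw [levelSeries, levelSeries, ← genSeries_add_one hfinite, ← genSeries_unit, add_comm,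
    ← genSeries_sumElim]
  · refine (genSeries_eq_of_bijective LevelInterval.bijective_elim_nil_consUp ?_ ?_).symm
    · rintro (_ | I) <;> simp [LevelInterval.nil, LevelInterval.consUp]
    · rintro (_ | I)
      · rfl
      · exact I.consUp.lower_path.suffixContacts_cons.trans (add_comm _ _)
  · exact fun _ => Set.toFinite _
  · refine fun n => (hfinite (n - 1)).subset ?_
    rintro I rfl
    rfl

theorem levelSeries_succ (m j : ℕ) :
    levelSeries m (j + 1) = levelSeries m 0 * delta (levelSeries m j) := by
  rw [← MarkedInterval.genSeries_eq_delta, levelSeries, levelSeries,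
    ← genSeries_prod LevelInterval.finite_count_eq MarkedInterval.finite_count_eq]
  refine (genSeries_eq_of_bijective
    ⟨MarkedInterval.injective_glue, MarkedInterval.surjective_glue⟩ ?_ ?_).symm
  · rintro ⟨I, M⟩
    simp only [MarkedInterval.glue, List.count_append, ne_eq, reduceCtorEq, not_false_eq_true,
      List.count_cons_of_ne]
    ring
  · rintro ⟨I, M⟩
    rw [MarkedInterval.glue,
      M.r_path.suffixContacts_append_false (M.s_path.append_zero_iff.2 I.lower_path),
      suffixContacts_append I.lower_path, add_comm]

theorem iterRightProd_replicate (m k : ℕ) :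
    iterRightProd (List.replicate (k + 1) (levelSeries m 0)) = levelSeries m k := by
  induction k with
  | zero => rfl
  | succ k ih =>
    rw [List.replicate_succ, List.replicate_succ, iterRightProd, ← List.replicate_succ, ih,
      rightProd, levelSeries_succ]

end MTamari

theorem mainTheorem6 (m : ℕ) (hm : 1 ≤ m) :
    MTamari.intervalSeries m =
      MTamari.opB (MTamari.intervalSeries m) (fun _ : Fin m => MTamari.intervalSeries m) + 1 := by
  obtain ⟨k, rfl⟩ : ∃ k, m = k + 1 := ⟨m - 1, by lia⟩
  rw [MTamari.intervalSeries_eq_levelSeries, MTamari.opB, List.ofFn_const,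
    MTamari.iterRightProd_replicate, MTamari.leftProd, MTamari.rightProd]
  conv_lhs => rw [MTamari.levelSeries_zero, MTamari.levelSeries_succ]
  ring
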